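/- Let $k$ be a field, $R=k[x,y]$, and let $I=(x^d,\,y^d,\,x^by^{d-b})\subset R$, where $d,b$ are integers with $d\ge 2$, $0\le b\le d-b$ and $\gcd(d,b)=1$. Let $\mathcal R_R(I)=R[IT]=\bigoplus_{i\ge 0}I^iT^i\subset R[T]$ be the Rees algebra of $I$. Then $\mathcal R_R(I)$ is almost Cohen--Macaulay, i.e. its depth on the maximal graded ideal $\big((x,y),\,\bigoplus_{i>0}I^iT^i\big)$ (the supremum of the lengths of the $\mathcal R_R(I)$-regular sequences contained in that ideal) is at least $2$. Moreover, $\mathcal R_R(I)$ is a Cohen--Macaulay ring if and only if $d=2$. -/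

import Mathlib

/-- The depth of a commutative ring `A` on an ideal `J` (the grade of `J`): the supremum of the
lengths of the `A`-regular sequences contained in `J`. -/
noncomputable def depthOn {A : Type*} [CommRing A] (J : Ideal A) : ℕ∞ :=
  ⨆ rs ∈ {rs : List A | (∀ r ∈ rs, r ∈ J) ∧ RingTheory.Sequence.IsRegular A rs},
    (rs.length : ℕ∞)

/-- A Noetherian local ring is Cohen–Macaulay if its depth equals its Krull dimension. -/
def IsCohenMacaulayLocal (A : Type*) [CommRing A] [IsLocalRing A] : Prop :=
  IsNoetherianRing A ∧
    ((depthOn (IsLocalRing.maximalIdeal A) : ℕ∞) : WithBot ℕ∞) = ringKrullDim A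

/-- A Noetherian ring is Cohen–Macaulay if its localizations at all maximal ideals are. -/
def IsCohenMacaulay (A : Type*) [CommRing A] : Prop :=
  IsNoetherianRing A ∧
    ∀ (P : Ideal A) [P.IsMaximal], IsCohenMacaulayLocal (Localization.AtPrime P)

/-- The ideal `A₊ = ⨁_{i > 0} Iⁱ Tⁱ` of the Rees algebra `R[IT] = ⨁_{i ≥ 0} Iⁱ Tⁱ ⊆ R[T]`. -/
noncomputable def reesIrrelevant {R : Type*} [CommRing R] (I : Ideal R) :
    Ideal (reesAlgebra I) :=
  RingHom.ker ((Polynomial.constantCoeff (R := R)).comp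
    (reesAlgebra I).val.toRingHom)

/-- The maximal graded ideal `(𝔪, R[IT]₊)` of the Rees algebra of an ideal `I` of the polynomial
ring `R = k[x₁, …, xₙ]`, where `𝔪 = (x₁, …, xₙ)`. -/
noncomputable def reesGradedMaximal {k : Type*} [Field k] {n : ℕ}
    (I : Ideal (MvPolynomial (Fin n) k)) : Ideal (reesAlgebra I) :=
  Ideal.map (algebraMap (MvPolynomial (Fin n) k) (reesAlgebra I))
      (Ideal.span (Set.range MvPolynomial.X)) ⊔ reesIrrelevant I

/-- The Rees algebra of an ideal of `k[x₁, …, xₙ]` is almost Cohen–Macaulay if its depth, computed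
on the maximal graded ideal, is at least `n`. -/
def IsAlmostCohenMacaulayRees {k : Type*} [Field k] {n : ℕ}
    (I : Ideal (MvPolynomial (Fin n) k)) : Prop :=
  (n : ℕ∞) ≤ depthOn (reesGradedMaximal I)

/-- The ideal `(x^d, y^d, x^b y^(d-b))` of `k[x, y]`. -/
noncomputable def binaryMonomialIdeal (k : Type*) [Field k] (d b : ℕ) :
    Ideal (MvPolynomial (Fin 2) k) :=
  Ideal.span {MvPolynomial.X 0 ^ d, MvPolynomial.X 1 ^ d,
    MvPolynomial.X 0 ^ b * MvPolynomial.X 1 ^ (d - b)}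

/-! Write `A` for the Rees algebra, with generators `x`, `y`, `u = x^d T`, `v = x^b y^(d-b) T`, `w =
y^d T` over `k`, let `M` be its graded maximal ideal and `e = d - b`.

Depth at least 2: `u` is regular, and a class modulo `u` killed by `y` and `w` vanishes because
`(I^(n+1) : (x^d, y^d)) = I^n` (`mem_pow_of_mul_mem_pow_succ`). Hence `Hom(A/M, A/u) = 0`, and `M`
contains a second regular element.

Not Cohen–Macaulay for `d ≥ 3`: `M` has height at least 3, so depth 3 would hold at `M`. Since `M =
Q + (u)` with `Q = (x, y, v, w)`, depth 3 forces every fraction `h` with `Q h ⊆ A_M` into `A_M`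
(`dvd_of_regular_triple`). A monomial `x^p y^q` of degree `dn`, `n` large, lies in `I^n` exactly
when `q` is in the semigroup `⟨d, e⟩`. With `F` the Frobenius number of that semigroup, `h =
x^(dn-F) y^F T^n` is outside `A_M`. Yet `x h`, `y h`, `v h`, `w h` are in `A`, because `F - 1`, `F +
1`, `F + e`, `F + d` belong to the semigroup (`exists_frobenius_gap`).

Cohen–Macaulay for `d = 2`: then `b = 1`, and `A` is free over `k[u, w + x, y]` with basis `1, x,
v`. A ring finite free over a polynomial ring is Cohen–Macaulay (`isCohenMacaulay_of_free`). -/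

open RingTheory.Sequence

/-! ### Fractions with denominator ideal `Q` in depth three -/

/-- With `L = (B : Q)` inside `K`, the quotient `L / B` is `Ext¹(B/Q, B)`. Depth 3 makes
multiplication by `t` surjective on it, and Nakayama then gives `L = B`. The surjectivity is carried
out by hand on the regular sequence. -/
theorem dvd_of_regular_triple_of_isFractionRing {B : Type*} (K : Type*) [CommRing B]
    [IsDomain B] [IsNoetherianRing B] [IsLocalRing B] [Field K] [Algebra B K] [IsFractionRing B K]
    {Q : Ideal B} {t : B} (hQ : Q ≠ ⊥)
    (hm : IsLocalRing.maximalIdeal B = Q ⊔ Ideal.span {t}) {a₁ a₂ a₃ : B}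
    (ha₁ : a₁ ∈ IsLocalRing.maximalIdeal B) (ha₂ : a₂ ∈ IsLocalRing.maximalIdeal B)
    (ha₃ : a₃ ∈ IsLocalRing.maximalIdeal B) (h₁ : a₁ ≠ 0)
    (h₂ : ∀ z, a₁ ∣ a₂ * z → a₁ ∣ z)
    (h₃ : ∀ z, a₃ * z ∈ Ideal.span {a₁, a₂} → z ∈ Ideal.span {a₁, a₂})
    {f g : B} (hf : f ≠ 0) (hfg : ∀ q ∈ Q, f ∣ q * g) : f ∣ g := by
  let ι : B →+* K := algebraMap B K
  have hι : Function.Injective ι := IsFractionRing.injective B K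
  let L : Submodule B K :=
    { carrier := {l | ∀ q ∈ Q, ∃ c, ι c = ι q * l}
      zero_mem' := fun q _ => ⟨0, by simp⟩
      add_mem' := fun {x y} hx hy q hq => by
        obtain ⟨c, hc⟩ := hx q hq
        obtain ⟨c', hc'⟩ := hy q hq
        exact ⟨c + c', by rw [map_add, hc, hc', mul_add]⟩
      smul_mem' := fun r x hx q hq => by
        obtain ⟨c, hc⟩ := hx q hq
        exact ⟨r * c, by rw [map_mul, hc, Algebra.smul_def]; ring⟩ }
  have hιa₁ : ι a₁ ≠ 0 := by rwa [map_ne_zero_iff _ hι]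
  have dec : ∀ a ∈ IsLocalRing.maximalIdeal B, ∃ q ∈ Q, ∃ s, a = q + t * s := by
    intro a ha
    rw [hm, Submodule.mem_sup] at ha
    obtain ⟨q, hq, z, hz, rfl⟩ := ha
    obtain ⟨s, rfl⟩ := Ideal.mem_span_singleton'.1 hz
    exact ⟨q, hq, s, by ring⟩
  obtain ⟨q₁, hq₁, s₁, e₁⟩ := dec a₁ ha₁
  obtain ⟨q₂, hq₂, s₂, e₂⟩ := dec a₂ ha₂
  obtain ⟨q₃, hq₃, s₃, e₃⟩ := dec a₃ ha₃
  -- This is the Nakayama inclusion `L ⊆ B + t L`.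
  have key : ∀ l ∈ L, ∃ l' ∈ L, ∃ w : B, l = ι w + t • l' := by
    intro l hl
    obtain ⟨b₁, hb₁⟩ := hl q₁ hq₁
    obtain ⟨b₂, hb₂⟩ := hl q₂ hq₂
    obtain ⟨c₃, hc₃⟩ := hl q₃ hq₃
    -- the obstruction `c = (q₂ s₁ - q₁ s₂) l` is a socle element modulo `(a₁, a₂)`
    have hc : a₃ * (b₂ * s₁ - b₁ * s₂) = a₂ * (c₃ * s₁ - s₃ * b₁) - a₁ * (c₃ * s₂ - s₃ * b₂) := by
      apply hι
      simp only [map_mul, map_sub, hb₁, hb₂, hc₃, e₁, e₂, e₃, map_add]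
      ring
    have hc' : b₂ * s₁ - b₁ * s₂ ∈ Ideal.span {a₁, a₂} := by
      apply h₃
      rw [hc, Ideal.mem_span_pair]
      exact ⟨-(c₃ * s₂ - s₃ * b₂), c₃ * s₁ - s₃ * b₁, by ring⟩
    obtain ⟨v, u, huv⟩ := Ideal.mem_span_pair.1 hc'
    -- So `(s₁ l - u) / a₁ = (s₂ l + v) / a₂`. This common fraction is `l'`; having both
    -- denominators, it becomes integral once multiplied into `B`-valued numerators, by regularity
    -- of `a₁, a₂`.
    have huv' : ι a₂ * (ι s₁ * l - ι u) = ι a₁ * (ι s₂ * l + ι v) := by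
      have h := congrArg ι huv
      simp only [map_mul, map_sub, map_add, hb₁, hb₂] at h
      simp only [e₁, e₂, map_mul, map_add] at h ⊢
      linear_combination -h
    refine ⟨(ι s₁ * l - ι u) / ι a₁, ?_, ?_⟩
    · intro q hq
      obtain ⟨c, hc⟩ := hl q hq
      have : a₁ ∣ s₁ * c - q * u := by
        apply h₂
        refine ⟨s₂ * c + q * v, hι ?_⟩
        simp only [map_mul, map_sub, map_add, hc]
        linear_combination ι q * huv'
      obtain ⟨z, hz⟩ := this
      refine ⟨z, ?_⟩
      have h := congrArg ι hz
      simp only [map_mul, map_sub, hc] at h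
      field_simp
      linear_combination -h
    -- Since `a₁ = q₁ + t s₁`, the difference `l - t l'` equals `(b₁ + t u) / a₁`.
    · have hw : a₁ ∣ b₁ + t * u := by
        apply h₂
        refine ⟨b₂ - t * v, hι ?_⟩
        simp only [map_mul, map_sub, map_add, hb₁, hb₂]
        simp only [e₁, e₂, map_mul, map_add] at huv' ⊢
        linear_combination -ι t * huv'
      obtain ⟨w, hw⟩ := hw
      refine ⟨w, ?_⟩
      have h := congrArg ι hw
      simp only [map_mul, map_add, hb₁] at h
      rw [Algebra.smul_def]
      change l = ι w + ι t * _
      field_simp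
      have h' := congrArg ι e₁
      simp only [map_mul, map_add] at h'
      linear_combination l * h' + h
  obtain ⟨q, hq, hq0⟩ := (Submodule.ne_bot_iff _).1 hQ
  have hιq : ι q ≠ 0 := by rwa [map_ne_zero_iff _ hι]
  -- For a nonzero `q ∈ Q`, `L` embeds in the cyclic module `q⁻¹ B`, and `B` is Noetherian.
  have hfg' : L.FG := by
    refine Submodule.FG.of_le (Submodule.fg_span_singleton (ι q)⁻¹) fun l hl => ?_
    obtain ⟨c, hc⟩ := hl q hq
    refine Submodule.mem_span_singleton.2 ⟨c, ?_⟩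
    rw [Algebra.smul_def]
    change ι c * _ = _
    rw [hc]
    field_simp
  have hL : L ≤ LinearMap.range (Algebra.linearMap B K) := by
    apply Submodule.le_of_le_smul_of_le_jacobson_bot (I := Ideal.span {t}) hfg'
    · refine le_trans ?_ (IsLocalRing.maximalIdeal_le_jacobson _)
      rw [hm]
      exact le_sup_right
    · intro l hl
      obtain ⟨l', hl', w, rfl⟩ := key l hl
      exact Submodule.add_mem_sup ⟨w, rfl⟩
        (Submodule.smul_mem_smul (Ideal.mem_span_singleton_self t) hl')
  have hιf : ι f ≠ 0 := by rwa [map_ne_zero_iff _ hι]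
  have hmem : ι g / ι f ∈ L := by
    intro q hq
    obtain ⟨c, hc⟩ := hfg q hq
    refine ⟨c, ?_⟩
    have h := congrArg ι hc
    simp only [map_mul] at h
    field_simp
    linear_combination -h
  obtain ⟨c, hc⟩ := hL hmem
  refine ⟨c, hι ?_⟩
  change ι c = _ at hc
  rw [map_mul, hc]
  field_simp

/-- If `t` and `Q` generate the maximal ideal of a Noetherian local domain admitting a regular
sequence `a₁, a₂, a₃`, then `Ext¹(B ⧸ Q, B) = 0`: every fraction `g / f` with `Q · (g / f) ⊆ B`
lies in `B`. -/
theorem dvd_of_regular_triple {B : Type*} [CommRing B] [IsDomain B] [IsNoetherianRing B]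
    [IsLocalRing B] {Q : Ideal B} {t : B} (hQ : Q ≠ ⊥)
    (hm : IsLocalRing.maximalIdeal B = Q ⊔ Ideal.span {t}) {a₁ a₂ a₃ : B}
    (ha₁ : a₁ ∈ IsLocalRing.maximalIdeal B) (ha₂ : a₂ ∈ IsLocalRing.maximalIdeal B)
    (ha₃ : a₃ ∈ IsLocalRing.maximalIdeal B) (h₁ : a₁ ≠ 0)
    (h₂ : ∀ z, a₁ ∣ a₂ * z → a₁ ∣ z)
    (h₃ : ∀ z, a₃ * z ∈ Ideal.span {a₁, a₂} → z ∈ Ideal.span {a₁, a₂})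
    {f g : B} (hf : f ≠ 0) (hfg : ∀ q ∈ Q, f ∣ q * g) : f ∣ g :=
  dvd_of_regular_triple_of_isFractionRing (FractionRing B) hQ hm ha₁ ha₂ ha₃ h₁ h₂ h₃ hf hfg

/-! ### Depth and regular sequences -/

/-- The case `n = 0` is excluded because over the zero ring not even the empty sequence is regular.
-/
theorem exists_isRegular_of_le_depthOn {A : Type*} [CommRing A] {J : Ideal A} {n : ℕ}
    (hn : n ≠ 0) (h : (n : ℕ∞) ≤ depthOn J) :
    ∃ rs : List A, (∀ r ∈ rs, r ∈ J) ∧ IsRegular A rs ∧ n ≤ rs.length := by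
  by_contra! hcon
  have : depthOn J ≤ ((n - 1 : ℕ) : ℕ∞) := by
    refine iSup₂_le fun rs hrs => ?_
    have := hcon rs hrs.1 hrs.2
    exact_mod_cast (by omega : rs.length ≤ n - 1)
  have h' := h.trans this
  norm_cast at h'
  omega

theorem le_depthOn {A : Type*} [CommRing A] {J : Ideal A} {rs : List A}
    (hJ : ∀ r ∈ rs, r ∈ J) (h : IsRegular A rs) : (rs.length : ℕ∞) ≤ depthOn J :=
  le_iSup₂ (f := fun (rs : List A) (_ : rs ∈ {rs : List A | (∀ r ∈ rs, r ∈ J) ∧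
    IsRegular A rs}) => (rs.length : ℕ∞)) rs ⟨hJ, h⟩

theorem depthOn_maximalIdeal_le_ringKrullDim {A : Type*} [CommRing A] [IsLocalRing A]
    [IsNoetherianRing A] :
    ((depthOn (IsLocalRing.maximalIdeal A) : ℕ∞) : WithBot ℕ∞) ≤ ringKrullDim A := by
  by_contra! hlt
  obtain ⟨n, hn⟩ : ∃ n : ℕ, ringKrullDim A = n := by
    have h1 : ringKrullDim A ≠ ⊥ := ringKrullDim_ne_bot
    have h2 : ringKrullDim A ≠ ⊤ := ringKrullDim_ne_top
    obtain ⟨m, hm⟩ := WithBot.ne_bot_iff_exists.1 h1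
    rw [← hm] at h2 ⊢
    have h3 : m ≠ ⊤ := fun h => h2 (by rw [h]; rfl)
    obtain ⟨n, rfl⟩ := ENat.ne_top_iff_exists.1 h3
    exact ⟨n, rfl⟩
  rw [hn] at hlt
  have hlt' : ((n : ℕ) : ℕ∞) < depthOn (IsLocalRing.maximalIdeal A) := by exact_mod_cast hlt
  obtain ⟨rs, -, hreg, hlen⟩ := exists_isRegular_of_le_depthOn (n := n + 1) (by omega)
    (by push_cast; exact Order.add_one_le_of_lt hlt')
  have hdim := ringKrullDim_add_length_eq_ringKrullDim_of_isRegular rs hreg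
  have : Nontrivial (A ⧸ Ideal.ofList rs) := by
    have := hreg.2
    rw [smul_eq_mul, Ideal.mul_top] at this
    exact Ideal.Quotient.nontrivial_iff.2 this.symm
  have h0 : 0 ≤ ringKrullDim (A ⧸ Ideal.ofList rs) := ringKrullDim_nonneg_of_nontrivial
  have h1 : ((rs.length : ℕ) : WithBot ℕ∞) ≤ n := by
    rw [← hn, ← hdim]
    simpa using add_le_add_left h0 ((rs.length : ℕ) : WithBot ℕ∞)
  have h2 : rs.length ≤ n := by exact_mod_cast h1
  omega

theorem exists_regular_triple {A : Type*} [CommRing A] [Nontrivial A] {J : Ideal A}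
    (h : (3 : ℕ∞) ≤ depthOn J) :
    ∃ a₁ ∈ J, ∃ a₂ ∈ J, ∃ a₃ ∈ J, a₁ ≠ 0 ∧ (∀ z, a₁ ∣ a₂ * z → a₁ ∣ z) ∧
      ∀ z, a₃ * z ∈ Ideal.span {a₁, a₂} → z ∈ Ideal.span {a₁, a₂} := by
  obtain ⟨rs, hJ, hreg, hlen⟩ := exists_isRegular_of_le_depthOn (n := 3) (by omega)
    (by exact_mod_cast h)
  obtain _ | ⟨a₁, _ | ⟨a₂, _ | ⟨a₃, rs⟩⟩⟩ := rs
  · simp at hlen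
  · simp at hlen
  · simp at hlen
  have hw := hreg.1.regular_mod_prev
  have w₀ := hw 0 (by simp)
  have w₁ := hw 1 (by simp)
  have w₂ := hw 2 (by simp)
  rw [isSMulRegular_on_quot_iff_lsmul_comap_le] at w₀ w₁ w₂
  refine ⟨a₁, hJ _ (by simp), a₂, hJ _ (by simp), a₃, hJ _ (by simp), ?_, fun z hz => ?_,
    fun z hz => ?_⟩
  · rintro rfl
    have : (1 : A) ∈ (⊥ : Ideal A) := by
      simpa using @w₀ 1 (by simp)
    exact one_ne_zero (Ideal.mem_bot.1 this)
  · have := @w₁ z (by simpa [Ideal.mem_span_singleton] using hz)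
    simpa [Ideal.mem_span_singleton] using this
  · rw [Ideal.span_insert] at hz ⊢
    have := @w₂ z (by simpa using hz)
    simpa using this

/-- If no nonzero class of `A ⧸ (u)` is annihilated by `M ∋ u`, then the depth on `M` is at
least two. -/
theorem two_le_depthOn {A : Type*} [CommRing A] [IsDomain A] [IsNoetherianRing A] {M : Ideal A}
    (hM : M ≠ ⊤) {u : A} (hu : u ∈ M) (hu0 : u ≠ 0)
    (hcolon : ∀ h, (∀ m ∈ M, u ∣ m * h) → u ∣ h) : (2 : ℕ∞) ≤ depthOn M := by
  have hquot : ∀ a : A, (Submodule.Quotient.mk a : QuotSMulTop u A) = 0 ↔ u ∣ a := by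
    intro a
    rw [Submodule.Quotient.mk_eq_zero, Submodule.mem_smul_pointwise_iff_exists]
    constructor
    · rintro ⟨c, -, rfl⟩
      exact ⟨c, rfl⟩
    · rintro ⟨c, rfl⟩
      exact ⟨c, trivial, rfl⟩
  -- A map out of `A/M` is determined by the image of `1`, which `M` annihilates. Over a Noetherian
  -- ring the vanishing of this Hom yields an element of `M = Ann(A/M)` regular on `A/u`.
  have hhom : Subsingleton ((A ⧸ M) →ₗ[A] QuotSMulTop u A) := by
    refine subsingleton_of_forall_eq 0 fun φ => ?_
    obtain ⟨h, hh⟩ := Submodule.Quotient.mk_surjective _ (φ (Submodule.Quotient.mk 1))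
    have hmul : ∀ m ∈ M, u ∣ m * h := by
      intro m hm
      rw [← hquot, ← smul_eq_mul, Submodule.Quotient.mk_smul, hh, ← map_smul,
        ← Submodule.Quotient.mk_smul, smul_eq_mul, mul_one,
        (Submodule.Quotient.mk_eq_zero M).2 hm, map_zero]
    have h0 := (hquot h).2 (hcolon h hmul)
    rw [hh] at h0
    refine LinearMap.ext fun z => ?_
    obtain ⟨a, rfl⟩ := Submodule.Quotient.mk_surjective _ z
    have : (Submodule.Quotient.mk a : A ⧸ M) = a • Submodule.Quotient.mk 1 := by
      rw [← Submodule.Quotient.mk_smul, smul_eq_mul, mul_one]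
    rw [this, map_smul, h0, smul_zero, LinearMap.zero_apply]
  obtain ⟨r, hr, hreg⟩ := IsSMulRegular.subsingleton_linearMap_iff.1 hhom
  rw [Ideal.annihilator_quotient] at hr
  have hmem : ∀ z ∈ [u, r], z ∈ M := by
    rintro z hz
    simp only [List.mem_cons, List.not_mem_nil, or_false] at hz
    rcases hz with rfl | rfl
    · exact hu
    · exact hr
  refine le_depthOn (rs := [u, r]) hmem ⟨?_, ?_⟩
  · rw [isWeaklyRegular_cons_iff, isWeaklyRegular_singleton_iff]
    exact ⟨IsSMulRegular.of_ne_zero hu0, hreg⟩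
  · intro htop
    have : Ideal.ofList [u, r] ≤ M := Ideal.span_le.2 hmem
    rw [smul_eq_mul, Ideal.mul_top] at htop
    exact hM (top_le_iff.1 (htop ▸ this : ⊤ ≤ M))

/-! ### Monomials in the powers of the ideal -/

section MonomialPowers

variable {k : Type*} [Field k] {d b : ℕ}

/-- Exponents of the monomial generators of the `n`-th power of `(x^d, y^d, x^b y^(d-b))`. -/
def powerExponents (d b n : ℕ) : Set (Fin 2 →₀ ℕ) :=
  {m | ∃ α β γ : ℕ, α + β + γ = n ∧ m 0 = d * α + b * γ ∧ m 1 = d * β + (d - b) * γ}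

/-- The exponent vector `(p, q)`. -/
noncomputable def exponentPair (p q : ℕ) : Fin 2 →₀ ℕ := Finsupp.single 0 p + Finsupp.single 1 q

@[simp]
theorem exponentPair_zero (p q : ℕ) : exponentPair p q 0 = p := by
  simp [exponentPair]

@[simp]
theorem exponentPair_one (p q : ℕ) : exponentPair p q 1 = q := by
  simp [exponentPair]

theorem X_pow_mul_X_pow_eq_monomial (p q : ℕ) :
    (MvPolynomial.X 0 ^ p * MvPolynomial.X 1 ^ q : MvPolynomial (Fin 2) k) =
      MvPolynomial.monomial (exponentPair p q) 1 := by
  rw [MvPolynomial.X_pow_eq_monomial, MvPolynomial.X_pow_eq_monomial, MvPolynomial.monomial_mul,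
    one_mul, exponentPair]

theorem monomial_eq_X_pow_mul_X_pow (m : Fin 2 →₀ ℕ) :
    (MvPolynomial.monomial m 1 : MvPolynomial (Fin 2) k) =
      MvPolynomial.X 0 ^ m 0 * MvPolynomial.X 1 ^ m 1 := by
  rw [X_pow_mul_X_pow_eq_monomial]
  congr 2
  ext i
  fin_cases i <;> simp

theorem X_zero_pow_mem : (MvPolynomial.X 0 ^ d : MvPolynomial (Fin 2) k) ∈
    binaryMonomialIdeal k d b := Ideal.subset_span (by simp)

theorem X_one_pow_mem : (MvPolynomial.X 1 ^ d : MvPolynomial (Fin 2) k) ∈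
    binaryMonomialIdeal k d b := Ideal.subset_span (by simp)

theorem X_mul_X_mem : (MvPolynomial.X 0 ^ b * MvPolynomial.X 1 ^ (d - b) :
    MvPolynomial (Fin 2) k) ∈ binaryMonomialIdeal k d b := Ideal.subset_span (by simp)

theorem binaryMonomialIdeal_pow (n : ℕ) : binaryMonomialIdeal k d b ^ n =
    Ideal.span ((fun m => MvPolynomial.monomial m (1 : k)) '' powerExponents d b n) := by
  apply le_antisymm
  · induction n with
    | zero =>
      rw [pow_zero, Ideal.one_eq_top]
      refine le_of_eq (Eq.symm ((Ideal.eq_top_iff_one _).2 (Ideal.subset_span ⟨0, ?_, rfl⟩)))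
      exact ⟨0, 0, 0, by simp⟩
    | succ n ih =>
      rw [pow_succ]
      refine (Ideal.mul_mono_left ih).trans ?_
      rw [binaryMonomialIdeal, Ideal.span_mul_span', Ideal.span_le]
      rintro _ ⟨_, ⟨m, ⟨α, β, γ, hn, h0, h1⟩, rfl⟩, g, hg, rfl⟩
      simp only [Set.mem_insert_iff, Set.mem_singleton_iff] at hg
      refine Ideal.subset_span ?_
      rcases hg with rfl | rfl | rfl
      · refine ⟨exponentPair (d * (α + 1) + b * γ) (d * β + (d - b) * γ),
          ⟨α + 1, β, γ, by omega, by simp, by simp⟩, ?_⟩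
        simp only [monomial_eq_X_pow_mul_X_pow, exponentPair_zero, exponentPair_one, h0, h1]
        ring
      · refine ⟨exponentPair (d * α + b * γ) (d * (β + 1) + (d - b) * γ),
          ⟨α, β + 1, γ, by omega, by simp, by simp⟩, ?_⟩
        simp only [monomial_eq_X_pow_mul_X_pow, exponentPair_zero, exponentPair_one, h0, h1]
        ring
      · refine ⟨exponentPair (d * α + b * (γ + 1)) (d * β + (d - b) * (γ + 1)),
          ⟨α, β, γ + 1, by omega, by simp, by simp⟩, ?_⟩
        simp only [monomial_eq_X_pow_mul_X_pow, exponentPair_zero, exponentPair_one, h0, h1]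
        ring
  · rw [Ideal.span_le]
    rintro _ ⟨m, ⟨α, β, γ, rfl, h0, h1⟩, rfl⟩
    have := Ideal.mul_mem_mul (Ideal.mul_mem_mul
      (Ideal.pow_mem_pow (X_zero_pow_mem (k := k) (d := d) (b := b)) α)
      (Ideal.pow_mem_pow (X_one_pow_mem (k := k) (d := d) (b := b)) β))
      (Ideal.pow_mem_pow (X_mul_X_mem (k := k) (d := d) (b := b)) γ)
    rw [← pow_add, ← pow_add] at this
    simp only [SetLike.mem_coe]
    convert this using 1
    rw [monomial_eq_X_pow_mul_X_pow, h0, h1]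
    ring

theorem mem_binaryMonomialIdeal_pow {n : ℕ} {p : MvPolynomial (Fin 2) k} :
    p ∈ binaryMonomialIdeal k d b ^ n ↔ ∀ m ∈ p.support, ∃ α β γ : ℕ, α + β + γ = n ∧
      d * α + b * γ ≤ m 0 ∧ d * β + (d - b) * γ ≤ m 1 := by
  rw [binaryMonomialIdeal_pow, MvPolynomial.mem_ideal_span_monomial_image]
  refine forall₂_congr fun m _ => ⟨?_, ?_⟩
  · rintro ⟨s, ⟨α, β, γ, hn, h0, h1⟩, hs⟩
    exact ⟨α, β, γ, hn, h0 ▸ hs 0, h1 ▸ hs 1⟩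
  · rintro ⟨α, β, γ, hn, h0, h1⟩
    refine ⟨exponentPair (d * α + b * γ) (d * β + (d - b) * γ),
      ⟨α, β, γ, hn, by simp, by simp⟩, fun i => ?_⟩
    fin_cases i
    · simpa using h0
    · simpa using h1

theorem X_pow_mul_X_pow_mem_pow {n p q : ℕ} :
    (MvPolynomial.X 0 ^ p * MvPolynomial.X 1 ^ q : MvPolynomial (Fin 2) k) ∈
      binaryMonomialIdeal k d b ^ n ↔ ∃ α β γ : ℕ, α + β + γ = n ∧
      d * α + b * γ ≤ p ∧ d * β + (d - b) * γ ≤ q := by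
  classical
  rw [mem_binaryMonomialIdeal_pow, X_pow_mul_X_pow_eq_monomial,
    MvPolynomial.support_monomial, if_neg one_ne_zero]
  simp

/-- The colon property behind the depth bound: `(I^(n+1) : (x^d, y^d)) = I^n`. -/
theorem mem_pow_of_mul_mem_pow_succ (hb : b ≤ d) {n : ℕ} {p : MvPolynomial (Fin 2) k}
    (hx : MvPolynomial.X 0 ^ d * p ∈ binaryMonomialIdeal k d b ^ (n + 1))
    (hy : MvPolynomial.X 1 ^ d * p ∈ binaryMonomialIdeal k d b ^ (n + 1)) :
    p ∈ binaryMonomialIdeal k d b ^ n := by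
  rw [mem_binaryMonomialIdeal_pow] at hx hy ⊢
  intro m hm
  have hm' := MvPolynomial.mem_support_iff.1 hm
  obtain ⟨α, β, γ, hn, h0, h1⟩ := hx (Finsupp.single 0 d + m) (by
    rw [MvPolynomial.mem_support_iff, MvPolynomial.X_pow_eq_monomial,
      MvPolynomial.coeff_monomial_mul, one_mul]; exact hm')
  obtain ⟨α', β', γ', hn', h0', h1'⟩ := hy (Finsupp.single 1 d + m) (by
    rw [MvPolynomial.mem_support_iff, MvPolynomial.X_pow_eq_monomial,
      MvPolynomial.coeff_monomial_mul, one_mul]; exact hm')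
  simp only [Finsupp.coe_add, Pi.add_apply, Finsupp.single_apply] at h0 h1 h0' h1'
  norm_num at h0 h1 h0' h1'
  -- A factor `x^d` in the first representation, or `y^d` in the second, can simply be cancelled.
  -- Otherwise the first uses only `y^d` and the mixed generator, so one of these is dropped; the
  -- second representation bounds the exponent of `x` from below.
  obtain _ | α := α
  · obtain _ | β' := β'
    · obtain _ | γ := γ
      · obtain _ | β := β
        · omega
        · exact ⟨0, β, 0, by omega, by simp, by rw [mul_add] at h1; omega⟩
      · refine ⟨0, β, γ, by omega, ?_, ?_⟩
        · have e1 : b * α' ≤ d * α' := Nat.mul_le_mul_right _ hb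
          have e2 : b * γ ≤ b * (α' + γ') := Nat.mul_le_mul_left _ (by omega)
          rw [mul_add] at e2
          omega
        · rw [mul_add] at h1
          omega
    · exact ⟨α', β', γ', by omega, h0', by rw [mul_add] at h1'; omega⟩
  · exact ⟨α, β, γ, by omega, by rw [mul_add] at h0; omega, h1⟩

/-- Monomial ideals: an element with nonzero constant term cannot multiply a monomial into
the ideal. -/
theorem mem_pow_of_mul_mem_pow {n p q : ℕ} {s : MvPolynomial (Fin 2) k}
    (hs : MvPolynomial.constantCoeff s ≠ 0)
    (h : s * (MvPolynomial.X 0 ^ p * MvPolynomial.X 1 ^ q) ∈ binaryMonomialIdeal k d b ^ n) :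
    (MvPolynomial.X 0 ^ p * MvPolynomial.X 1 ^ q : MvPolynomial (Fin 2) k) ∈
      binaryMonomialIdeal k d b ^ n := by
  rw [X_pow_mul_X_pow_mem_pow]
  rw [mem_binaryMonomialIdeal_pow] at h
  simpa using h (exponentPair p q) (by
    rw [MvPolynomial.mem_support_iff, X_pow_mul_X_pow_eq_monomial,
      MvPolynomial.coeff_mul_monomial', if_pos le_rfl, mul_one]
    simpa [MvPolynomial.constantCoeff_eq] using hs)

end MonomialPowers

/-! ### Generators and the graded maximal ideal of the Rees algebra -/

section ReesStructure

variable (k : Type*) [Field k] (d b : ℕ)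

/-- The Rees algebra of `(x^d, y^d, x^b y^(d-b))`. -/
abbrev BinaryRees : Type _ := reesAlgebra (binaryMonomialIdeal k d b)

namespace BinaryRees

/-- The element `x`, in degree zero. -/
noncomputable def x : BinaryRees k d b :=
  algebraMap (MvPolynomial (Fin 2) k) _ (MvPolynomial.X 0)

/-- The element `y`, in degree zero. -/
noncomputable def y : BinaryRees k d b :=
  algebraMap (MvPolynomial (Fin 2) k) _ (MvPolynomial.X 1)

/-- The element `x^d T`. -/
noncomputable def u : BinaryRees k d b :=
  ⟨Polynomial.monomial 1 (MvPolynomial.X 0 ^ d),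
    reesAlgebra.monomial_mem.2 (by rw [pow_one]; exact X_zero_pow_mem)⟩

/-- The element `x^b y^(d-b) T`. -/
noncomputable def v : BinaryRees k d b :=
  ⟨Polynomial.monomial 1 (MvPolynomial.X 0 ^ b * MvPolynomial.X 1 ^ (d - b)),
    reesAlgebra.monomial_mem.2 (by rw [pow_one]; exact X_mul_X_mem)⟩

/-- The element `y^d T`. -/
noncomputable def w : BinaryRees k d b :=
  ⟨Polynomial.monomial 1 (MvPolynomial.X 1 ^ d),
    reesAlgebra.monomial_mem.2 (by rw [pow_one]; exact X_one_pow_mem)⟩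

/-- The augmentation of the Rees algebra onto the ground field. -/
noncomputable def aug : BinaryRees k d b →+* k :=
  (MvPolynomial.constantCoeff.comp Polynomial.constantCoeff).comp
    (reesAlgebra (binaryMonomialIdeal k d b)).val.toRingHom

variable {k d b}

theorem coe_x : (x k d b : Polynomial (MvPolynomial (Fin 2) k)) =
    Polynomial.C (MvPolynomial.X 0) := rfl

theorem coe_y : (y k d b : Polynomial (MvPolynomial (Fin 2) k)) =
    Polynomial.C (MvPolynomial.X 1) := rfl

theorem coe_u : (u k d b : Polynomial (MvPolynomial (Fin 2) k)) =
    Polynomial.C (MvPolynomial.X 0 ^ d) * Polynomial.X :=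
  (Polynomial.C_mul_X_eq_monomial).symm

theorem coe_v : (v k d b : Polynomial (MvPolynomial (Fin 2) k)) =
    Polynomial.C (MvPolynomial.X 0 ^ b * MvPolynomial.X 1 ^ (d - b)) * Polynomial.X :=
  (Polynomial.C_mul_X_eq_monomial).symm

theorem coe_w : (w k d b : Polynomial (MvPolynomial (Fin 2) k)) =
    Polynomial.C (MvPolynomial.X 1 ^ d) * Polynomial.X :=
  (Polynomial.C_mul_X_eq_monomial).symm

theorem coe_algebraMap (c : k) :
    (algebraMap k (BinaryRees k d b) c : Polynomial (MvPolynomial (Fin 2) k)) =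
      Polynomial.C (MvPolynomial.C c) := rfl

theorem aug_apply (a : BinaryRees k d b) :
    aug k d b a = MvPolynomial.constantCoeff
      ((a : Polynomial (MvPolynomial (Fin 2) k)).coeff 0) := rfl

theorem aug_algebraMap (c : k) : aug k d b (algebraMap k _ c) = c := by
  rw [aug_apply, coe_algebraMap]
  simp

theorem aug_x : aug k d b (x k d b) = 0 := by
  rw [aug_apply, coe_x]
  simp

theorem aug_y : aug k d b (y k d b) = 0 := by
  rw [aug_apply, coe_y]
  simp

theorem aug_u : aug k d b (u k d b) = 0 := by
  rw [aug_apply, coe_u]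
  simp

theorem aug_v : aug k d b (v k d b) = 0 := by
  rw [aug_apply, coe_v]
  simp

theorem aug_w : aug k d b (w k d b) = 0 := by
  rw [aug_apply, coe_w]
  simp

theorem eq_top_of_mem (S : Subalgebra k (BinaryRees k d b)) (hx : x k d b ∈ S)
    (hy : y k d b ∈ S) (hu : u k d b ∈ S) (hv : v k d b ∈ S) (hw : w k d b ∈ S) : S = ⊤ := by
  have hR : ∀ r : MvPolynomial (Fin 2) k, algebraMap _ (BinaryRees k d b) r ∈ S := by
    intro r
    induction r using MvPolynomial.induction_on with
    | C c => exact S.algebraMap_mem c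
    | add p q hp hq => rw [map_add]; exact S.add_mem hp hq
    | mul_X p i hp =>
      rw [map_mul]
      refine S.mul_mem hp ?_
      fin_cases i
      · exact hx
      · exact hy
  have hI : ∀ r (hr : r ∈ binaryMonomialIdeal k d b), ∀ h,
      (⟨Polynomial.monomial 1 r, h⟩ : BinaryRees k d b) ∈ S := by
    intro r hr
    induction hr using Submodule.span_induction with
    | mem g hg =>
      intro h
      simp only [Set.mem_insert_iff, Set.mem_singleton_iff] at hg
      rcases hg with rfl | rfl | rfl
      · exact hu
      · exact hw
      · exact hv
    | zero =>
      intro h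
      convert S.zero_mem
      simp
    | add p q hp hq ihp ihq =>
      intro h
      have hp' : Polynomial.monomial 1 p ∈ reesAlgebra (binaryMonomialIdeal k d b) :=
        reesAlgebra.monomial_mem.2 (by rw [pow_one]; exact hp)
      have hq' : Polynomial.monomial 1 q ∈ reesAlgebra (binaryMonomialIdeal k d b) :=
        reesAlgebra.monomial_mem.2 (by rw [pow_one]; exact hq)
      convert S.add_mem (ihp hp') (ihq hq')
      exact map_add _ _ _
    | smul a p hp ih =>
      intro h
      have hp' : Polynomial.monomial 1 p ∈ reesAlgebra (binaryMonomialIdeal k d b) :=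
        reesAlgebra.monomial_mem.2 (by rw [pow_one]; exact hp)
      convert S.mul_mem (hR a) (ih hp')
      change _ = Polynomial.C a * Polynomial.monomial 1 p
      rw [Polynomial.C_mul_monomial, smul_eq_mul]
  have hA : ∀ a ∈ Algebra.adjoin (MvPolynomial (Fin 2) k)
      (Submodule.map (Polynomial.monomial 1 : MvPolynomial (Fin 2) k →ₗ[MvPolynomial (Fin 2) k] _)
        (binaryMonomialIdeal k d b) : Set (Polynomial (MvPolynomial (Fin 2) k))),
      ∀ h, (⟨a, h⟩ : BinaryRees k d b) ∈ S := by
    intro a ha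
    induction ha using Algebra.adjoin_induction with
    | mem p hp =>
      obtain ⟨r, hr, rfl⟩ := hp
      exact hI r hr
    | algebraMap r => exact fun _ => hR r
    | add p q hp hq ihp ihq =>
      intro h
      rw [adjoin_monomial_eq_reesAlgebra] at hp hq
      have e : (⟨p + q, h⟩ : BinaryRees k d b) = ⟨p, hp⟩ + ⟨q, hq⟩ := rfl
      rw [e]
      exact S.add_mem (ihp hp) (ihq hq)
    | mul p q hp hq ihp ihq =>
      intro h
      rw [adjoin_monomial_eq_reesAlgebra] at hp hq
      have e : (⟨p * q, h⟩ : BinaryRees k d b) = ⟨p, hp⟩ * ⟨q, hq⟩ := rfl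
      rw [e]
      exact S.mul_mem (ihp hp) (ihq hq)
  rw [eq_top_iff]
  rintro ⟨a, ha⟩ -
  have ha' := ha
  rw [← adjoin_monomial_eq_reesAlgebra] at ha'
  exact hA a ha' ha

/-- The elements congruent to their augmentation modulo `J` form a `k`-subalgebra, so it suffices to
test the five generators. -/
theorem ker_aug_le : RingHom.ker (aug k d b) ≤
    Ideal.span {x k d b, y k d b, v k d b, w k d b} ⊔ Ideal.span {u k d b} := by
  set J := Ideal.span {x k d b, y k d b, v k d b, w k d b} ⊔ Ideal.span {u k d b} with hJ
  have hu : u k d b ∈ J := Ideal.mem_sup_right (Ideal.mem_span_singleton_self _)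
  have hg : ∀ z ∈ ({x k d b, y k d b, v k d b, w k d b} : Set (BinaryRees k d b)), z ∈ J :=
    fun z hz => Ideal.mem_sup_left (Ideal.subset_span hz)
  let S : Subalgebra k (BinaryRees k d b) :=
    { carrier := {a | a - algebraMap k _ (aug k d b a) ∈ J}
      mul_mem' := fun {p q} hp hq => by
        have : p * q - algebraMap k _ (aug k d b (p * q)) =
            p * (q - algebraMap k _ (aug k d b q)) +
              algebraMap k _ (aug k d b q) * (p - algebraMap k _ (aug k d b p)) := by
          rw [map_mul, map_mul]; ring
        rw [Set.mem_ofPred_eq, this]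
        exact J.add_mem (J.mul_mem_left _ hq) (J.mul_mem_left _ hp)
      add_mem' := fun {p q} hp hq => by
        have : p + q - algebraMap k _ (aug k d b (p + q)) =
            (p - algebraMap k _ (aug k d b p)) + (q - algebraMap k _ (aug k d b q)) := by
          rw [map_add, map_add]; ring
        rw [Set.mem_ofPred_eq, this]
        exact J.add_mem hp hq
      algebraMap_mem' := fun c => by
        rw [Set.mem_ofPred_eq, aug_algebraMap, sub_self]
        exact J.zero_mem }
  have hS : S = ⊤ := by
    refine eq_top_of_mem S ?_ ?_ ?_ ?_ ?_
    · change _ - _ ∈ J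
      rw [aug_x, map_zero, sub_zero]
      exact hg _ (by simp)
    · change _ - _ ∈ J
      rw [aug_y, map_zero, sub_zero]
      exact hg _ (by simp)
    · change _ - _ ∈ J
      rw [aug_u, map_zero, sub_zero]
      exact hu
    · change _ - _ ∈ J
      rw [aug_v, map_zero, sub_zero]
      exact hg _ (by simp)
    · change _ - _ ∈ J
      rw [aug_w, map_zero, sub_zero]
      exact hg _ (by simp)
  intro a ha
  have : a ∈ S := hS ▸ Algebra.mem_top
  change a - _ ∈ J at this
  rwa [RingHom.mem_ker.1 ha, map_zero, sub_zero] at this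

theorem span_le_gradedMaximal :
    Ideal.span {x k d b, y k d b, v k d b, w k d b} ⊔ Ideal.span {u k d b} ≤
      reesGradedMaximal (binaryMonomialIdeal k d b) := by
  have h1 : ∀ i, algebraMap _ (BinaryRees k d b) (MvPolynomial.X i) ∈
      reesGradedMaximal (binaryMonomialIdeal k d b) := fun i =>
    Ideal.mem_sup_left (Ideal.mem_map_of_mem _ (Ideal.subset_span ⟨i, rfl⟩))
  have h2 : ∀ a : BinaryRees k d b, (a : Polynomial (MvPolynomial (Fin 2) k)).coeff 0 = 0 →
      a ∈ reesGradedMaximal (binaryMonomialIdeal k d b) := fun a ha =>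
    Ideal.mem_sup_right (RingHom.mem_ker.2 ha)
  refine sup_le (Ideal.span_le.2 ?_) (Ideal.span_le.2 ?_)
  · rintro z (rfl | rfl | rfl | rfl)
    · exact h1 0
    · exact h1 1
    · exact h2 _ (by rw [coe_v]; simp)
    · exact h2 _ (by rw [coe_w]; simp)
  · rintro z rfl
    exact h2 _ (by rw [coe_u]; simp)

theorem gradedMaximal_le_ker_aug :
    reesGradedMaximal (binaryMonomialIdeal k d b) ≤ RingHom.ker (aug k d b) := by
  refine sup_le (Ideal.map_le_iff_le_comap.2 (Ideal.span_le.2 ?_)) fun a ha => ?_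
  · rintro _ ⟨i, rfl⟩
    fin_cases i
    · exact aug_x
    · exact aug_y
  · rw [RingHom.mem_ker, aug_apply]
    have : (a : Polynomial (MvPolynomial (Fin 2) k)).coeff 0 = 0 := ha
    rw [this, map_zero]

theorem gradedMaximal_eq_ker_aug :
    reesGradedMaximal (binaryMonomialIdeal k d b) = RingHom.ker (aug k d b) :=
  le_antisymm gradedMaximal_le_ker_aug (ker_aug_le.trans span_le_gradedMaximal)

theorem gradedMaximal_eq_span :
    reesGradedMaximal (binaryMonomialIdeal k d b) =
      Ideal.span {x k d b, y k d b, v k d b, w k d b} ⊔ Ideal.span {u k d b} :=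
  le_antisymm (gradedMaximal_le_ker_aug.trans ker_aug_le) span_le_gradedMaximal

instance : (reesGradedMaximal (binaryMonomialIdeal k d b)).IsMaximal := by
  rw [gradedMaximal_eq_ker_aug]
  exact RingHom.ker_isMaximal_of_surjective _ fun c => ⟨algebraMap k _ c, aug_algebraMap c⟩

end BinaryRees

end ReesStructure

/-! ### Depth at least two -/

namespace BinaryRees

section Depth

variable {k : Type*} [Field k] {d b : ℕ}

theorem u_ne_zero : u k d b ≠ 0 := by
  intro h
  have h' := congrArg (fun a : BinaryRees k d b =>
    (a : Polynomial (MvPolynomial (Fin 2) k)).coeff 1) h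
  simp only [coe_u, Polynomial.coeff_C_mul, Polynomial.coeff_X_one, mul_one] at h'
  exact pow_ne_zero d (MvPolynomial.X_ne_zero (0 : Fin 2)) h'

theorem X_zero_pow_dvd_of_dvd_mul {n m : ℕ} {p : MvPolynomial (Fin 2) k}
    (h : MvPolynomial.X 0 ^ n ∣ MvPolynomial.X 1 ^ m * p) : MvPolynomial.X 0 ^ n ∣ p := by
  have hp : Prime (MvPolynomial.X 0 : MvPolynomial (Fin 2) k) := MvPolynomial.X_prime
  refine hp.pow_dvd_of_dvd_mul_left n (fun h' => ?_) h
  have h1 := hp.dvd_of_dvd_pow h'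
  rw [MvPolynomial.X_dvd_X] at h1
  simp at h1

theorem u_dvd_of_dvd_mul (hb : b ≤ d) {h : BinaryRees k d b} (hy : u k d b ∣ y k d b * h)
    (hw : u k d b ∣ w k d b * h) : u k d b ∣ h := by
  obtain ⟨c, hc⟩ := hy
  obtain ⟨c', hc'⟩ := hw
  replace hc := congrArg (fun a : BinaryRees k d b =>
    (a : Polynomial (MvPolynomial (Fin 2) k))) hc
  replace hc' := congrArg (fun a : BinaryRees k d b =>
    (a : Polynomial (MvPolynomial (Fin 2) k))) hc'
  simp only [MulMemClass.coe_mul, coe_y, coe_u, coe_w] at hc hc'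
  obtain ⟨h, hh⟩ := h
  obtain ⟨c', hcmem⟩ := c'
  simp only at hc hc'
  have hcoeff : ∀ n, MvPolynomial.X 1 ^ d * h.coeff n = MvPolynomial.X 0 ^ d * c'.coeff n := by
    intro n
    have := congrArg (fun p => Polynomial.coeff p (n + 1)) hc'
    simpa only [mul_assoc, Polynomial.coeff_C_mul, Polynomial.coeff_X_mul] using this
  -- A multiple of `u` has no term of degree 0 in `T`; this is the only use of `y`.
  have h0 : h.coeff 0 = 0 := by
    have := congrArg (fun p => Polynomial.coeff p 0) hc
    simpa [mul_assoc] using this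
  obtain ⟨h', rfl⟩ := Polynomial.X_dvd_iff.2 h0
  obtain ⟨g, rfl⟩ : Polynomial.C (MvPolynomial.X 0 ^ d) ∣ h' := by
    rw [Polynomial.C_dvd_iff_dvd_coeff]
    intro n
    have := hcoeff (n + 1)
    rw [Polynomial.coeff_X_mul] at this
    exact X_zero_pow_dvd_of_dvd_mul ⟨_, this⟩
  -- In `k[x, y][T]` now `h = u g`; the colon property puts the coefficients of `g` in the powers of
  -- the ideal.
  refine ⟨⟨g, fun n => mem_pow_of_mul_mem_pow_succ hb ?_ ?_⟩, Subtype.ext ?_⟩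
  · have := hh (n + 1)
    rwa [Polynomial.coeff_X_mul, Polynomial.coeff_C_mul] at this
  · have h1 := hcoeff (n + 1)
    rw [Polynomial.coeff_X_mul, Polynomial.coeff_C_mul] at h1
    have h2 : MvPolynomial.X 1 ^ d * g.coeff n = c'.coeff (n + 1) := by
      apply mul_left_cancel₀ (pow_ne_zero d (MvPolynomial.X_ne_zero (0 : Fin 2)))
      rw [← h1]
      ring
    rw [h2]
    exact hcmem (n + 1)
  · simp only [MulMemClass.coe_mul, coe_u]
    ring

theorem isAlmostCohenMacaulayRees (hb : b ≤ d) :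
    IsAlmostCohenMacaulayRees (binaryMonomialIdeal k d b) := by
  have hle := span_le_gradedMaximal (k := k) (d := d) (b := b)
  refine two_le_depthOn (u := u k d b) (Ideal.IsMaximal.ne_top inferInstance)
    (hle (Ideal.mem_sup_right (Ideal.mem_span_singleton_self _))) u_ne_zero fun h hmul =>
    u_dvd_of_dvd_mul hb (hmul _ ?_) (hmul _ ?_)
  · exact hle (Ideal.mem_sup_left (Ideal.subset_span (by simp)))
  · exact hle (Ideal.mem_sup_left (Ideal.subset_span (by simp)))

end Depth

end BinaryRees

/-! ### The Frobenius number of a numerical semigroup -/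

section Numerical

/-- The Frobenius number `F` of a coprime pair `d ≥ 3`, `e ≥ 2` is not of the form `d β + e γ`,
while `F - 1` and all larger numbers are. -/
theorem exists_frobenius_gap {d e : ℕ} (hd : 3 ≤ d) (he : 2 ≤ e) (h : Nat.Coprime d e) :
    ∃ F : ℕ, (¬ ∃ β γ, d * β + e * γ = F) ∧ (∀ s, F < s → ∃ β γ, d * β + e * γ = s) ∧
      ∃ β γ, d * β + e * γ + 1 = F := by
  obtain ⟨h1, h2⟩ := frobeniusNumber_iff.1 (frobeniusNumber_pair h (by omega) (by omega))
  simp only [AddSubmonoid.mem_closure_pair, smul_eq_mul] at h1 h2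
  have hde : d + e + 1 ≤ d * e := by
    obtain ⟨d, rfl⟩ := Nat.exists_eq_add_of_le hd
    obtain ⟨e, rfl⟩ := Nat.exists_eq_add_of_le he
    ring_nf
    nlinarith [Nat.zero_le (d * e)]
  refine ⟨d * e - d - e, fun ⟨β, γ, hβ⟩ => h1 ⟨β, γ, by linarith⟩, fun s hs => ?_, ?_⟩
  · obtain ⟨β, γ, hβ⟩ := h2 s hs
    exact ⟨β, γ, by linarith⟩
  · -- write `d * j = e * g + 1` with `1 ≤ g < d`; then `F - 1 = d * (e - 1 - j) + e * (g - 1)`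
    obtain ⟨g, hg, hgd, j, hj⟩ : ∃ g, 1 ≤ g ∧ g < d ∧ ∃ j, d * j = e * g + 1 := by
      -- Here `m` inverts `e` modulo `d`. With `e m = d q + 1`, the choices `d - m` for `g` and `e -
      -- q` for `j` work.
      obtain ⟨m, hlt, hm'⟩ := Nat.exists_mul_mod_eq_one_of_coprime h.symm (by omega)
      have hpos : 1 ≤ m := by
        by_contra! hcon
        obtain rfl : m = 0 := by omega
        simp at hm'
      obtain ⟨g, rfl⟩ := Nat.exists_eq_add_of_lt hlt
      obtain ⟨q, hdiv⟩ : ∃ q, (m + g + 1) * q + 1 = e * m :=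
        ⟨e * m / (m + g + 1), by
          have := Nat.div_add_mod (e * m) (m + g + 1)
          rwa [hm'] at this⟩
      have hqe : q ≤ e := by
        by_contra! hcon
        have e1 : (m + g + 1) * e ≤ (m + g + 1) * q := Nat.mul_le_mul_left _ hcon.le
        nlinarith
      obtain ⟨j, rfl⟩ := Nat.exists_eq_add_of_le hqe
      refine ⟨g + 1, by omega, by omega, j, ?_⟩
      linear_combination -hdiv
    have hje : j < e := by
      by_contra! hcon
      have e1 : d * e ≤ d * j := Nat.mul_le_mul_left _ hcon
      have e2 : e * (g + 1) ≤ e * d := Nat.mul_le_mul_left _ hgd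
      nlinarith
    obtain ⟨i, rfl⟩ := Nat.exists_eq_add_of_lt hje
    obtain ⟨g, rfl⟩ := Nat.exists_eq_add_of_le hg
    refine ⟨i, g, ?_⟩
    have : d * (j + i + 1) = d * i + (j + i + 1) * g + 1 + d + (j + i + 1) := by
      linear_combination hj
    omega

end Numerical

/-! ### Failure of the Cohen–Macaulay property for `d ≥ 3` -/

namespace BinaryRees

section NotCohenMacaulay

variable {k : Type*} [Field k] {d b : ℕ}

/-- The chain is `0 < A₊ < A₊ + (x) < M`, where `ε` sets `x = 0`. -/
theorem three_le_height_gradedMaximal :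
    3 ≤ (reesGradedMaximal (binaryMonomialIdeal k d b)).height := by
  let c₀ : BinaryRees k d b →+* MvPolynomial (Fin 2) k :=
    Polynomial.constantCoeff.comp (reesAlgebra (binaryMonomialIdeal k d b)).val.toRingHom
  have hc₀ : ∀ a : BinaryRees k d b,
      c₀ a = (a : Polynomial (MvPolynomial (Fin 2) k)).coeff 0 := fun _ => rfl
  let ε : MvPolynomial (Fin 2) k →+* Polynomial k :=
    (MvPolynomial.aeval ![0, Polynomial.X]).toRingHom
  have hε₀ : ε (MvPolynomial.X 0) = 0 := by simp [ε]
  have hε₁ : ε (MvPolynomial.X 1) = Polynomial.X := by simp [ε]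
  let P₁ := RingHom.ker c₀
  let P₂ := RingHom.ker (ε.comp c₀)
  have : P₁.IsPrime := RingHom.ker_isPrime _
  have : P₂.IsPrime := RingHom.ker_isPrime _
  have hP₁ : (⊥ : Ideal (BinaryRees k d b)) < P₁ := by
    rw [bot_lt_iff_ne_bot, Submodule.ne_bot_iff]
    refine ⟨u k d b, ?_, u_ne_zero⟩
    rw [RingHom.mem_ker, hc₀, coe_u]
    simp
  have hP₂ : P₁ < P₂ := by
    refine SetLike.lt_iff_le_and_exists.2 ⟨fun a ha => ?_, x k d b, ?_, ?_⟩
    · rw [RingHom.mem_ker, RingHom.comp_apply, RingHom.mem_ker.1 ha, map_zero]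
    · rw [RingHom.mem_ker, RingHom.comp_apply, hc₀, coe_x, Polynomial.coeff_C_zero, hε₀]
    · rw [RingHom.mem_ker, hc₀, coe_x, Polynomial.coeff_C_zero]
      exact MvPolynomial.X_ne_zero _
  have hP₃ : P₂ < reesGradedMaximal (binaryMonomialIdeal k d b) := by
    rw [gradedMaximal_eq_ker_aug]
    refine SetLike.lt_iff_le_and_exists.2 ⟨fun a ha => ?_, y k d b, aug_y, ?_⟩
    · have haug : (MvPolynomial.constantCoeff : MvPolynomial (Fin 2) k →+* k) =
          Polynomial.constantCoeff.comp ε := by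
        ext i
        · simp [ε]
        · fin_cases i <;> simp [ε]
      rw [RingHom.mem_ker, aug_apply, haug, RingHom.comp_apply]
      have : ε ((a : Polynomial (MvPolynomial (Fin 2) k)).coeff 0) = 0 := ha
      rw [this, map_zero]
    · rw [RingHom.mem_ker, RingHom.comp_apply, hc₀, coe_y, Polynomial.coeff_C_zero, hε₁]
      exact Polynomial.X_ne_zero
  have i₁ := Ideal.height_add_one_le_of_lt_of_isPrime hP₁
  have i₂ := Ideal.height_add_one_le_of_lt_of_isPrime hP₂
  have i₃ := Ideal.height_add_one_le_of_lt_of_isPrime hP₃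
  calc (3 : ℕ∞) = 0 + 1 + 1 + 1 := by norm_num
    _ ≤ (⊥ : Ideal (BinaryRees k d b)).height + 1 + 1 + 1 := by gcongr; exact bot_le
    _ ≤ P₁.height + 1 + 1 := by gcongr
    _ ≤ P₂.height + 1 := by gcongr
    _ ≤ _ := i₃

/-- With `α = n - β - γ` the generator has degree `dn`, so its `x`-exponent is `dn - (dβ + eγ)`.
Membership thus reduces to representing a number in `⟨d, e⟩`. -/
theorem X_pow_mul_X_pow_mem_pow_of_le (hb : b ≤ d) {n p q β γ : ℕ} (hn : β + γ ≤ n)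
    (hq : d * β + (d - b) * γ ≤ q) (hp : d * n ≤ p + (d * β + (d - b) * γ)) :
    (MvPolynomial.X 0 ^ p * MvPolynomial.X 1 ^ q : MvPolynomial (Fin 2) k) ∈
      binaryMonomialIdeal k d b ^ n := by
  rw [X_pow_mul_X_pow_mem_pow]
  obtain ⟨α, rfl⟩ := Nat.exists_eq_add_of_le hn
  obtain ⟨e, rfl⟩ := Nat.exists_eq_add_of_le hb
  rw [Nat.add_sub_cancel_left] at *
  exact ⟨α, β, γ, by omega, by nlinarith, hq⟩

/-- The monomial `x^p y^q T^n` of the Rees algebra. -/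
noncomputable def mono (n p q : ℕ) (h : (MvPolynomial.X 0 ^ p * MvPolynomial.X 1 ^ q :
    MvPolynomial (Fin 2) k) ∈ binaryMonomialIdeal k d b ^ n) : BinaryRees k d b :=
  ⟨Polynomial.monomial n (MvPolynomial.X 0 ^ p * MvPolynomial.X 1 ^ q),
    reesAlgebra.monomial_mem.2 h⟩

theorem coe_mono {n p q : ℕ} (h : (MvPolynomial.X 0 ^ p * MvPolynomial.X 1 ^ q :
    MvPolynomial (Fin 2) k) ∈ binaryMonomialIdeal k d b ^ n) :
    (mono n p q h : Polynomial (MvPolynomial (Fin 2) k)) =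
      Polynomial.C (MvPolynomial.X 0) ^ p * Polynomial.C (MvPolynomial.X 1) ^ q *
        Polynomial.X ^ n := by
  change Polynomial.monomial n _ = _
  rw [← Polynomial.C_mul_X_pow_eq_monomial]
  simp only [map_mul, map_pow]

theorem not_isCohenMacaulay (hd : 3 ≤ d) (hb : b ≤ d - b) (hgcd : Nat.gcd d b = 1) :
    ¬ IsCohenMacaulay (BinaryRees k d b) := by
  intro hCM
  set e := d - b with he
  have hbd : b ≤ d := by omega
  have hbe : b + e = d := by omega
  have hcop : Nat.Coprime d e := by
    have : Nat.Coprime d (d - b) := (Nat.coprime_self_sub_right hbd).2 hgcd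
    exact this
  obtain ⟨F, hF, hgt, β₀, γ₀, hpred⟩ := exists_frobenius_gap hd (by omega) hcop
  -- Large enough that `β + γ ≤ n` for every representation of a number up to `F + d`, and that `F ≤
  -- dn`.
  set n := F + d + e with hn
  obtain ⟨p, hp⟩ : ∃ p, d * n = F + p := Nat.exists_eq_add_of_le (by nlinarith)
  have hsmall : ∀ β γ, β + γ ≤ d * β + e * γ := fun β γ =>
    add_le_add (Nat.le_mul_of_pos_left _ (by omega)) (Nat.le_mul_of_pos_left _ (by omega))
  -- the four products `q · x^p y^F T^n`
  have hdvd : ∀ q ∈ ({x k d b, y k d b, v k d b, w k d b} : Set (BinaryRees k d b)),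
      x k d b ^ F ∣ q * (u k d b ^ n * y k d b ^ F) := by
    -- The quotients are monomials, in `A` because `F - 1`, `F + 1`, `F + e` and `F + d`
    -- respectively are representable.
    rintro q (rfl | rfl | rfl | rfl)
    · have := hsmall β₀ γ₀
      refine ⟨mono n (p + 1) F
        (X_pow_mul_X_pow_mem_pow_of_le hbd (β := β₀) (γ := γ₀) (by omega) ?_ ?_), Subtype.ext ?_⟩
      · rw [← he]; omega
      · rw [← he]; omega
      · simp only [MulMemClass.coe_mul, SubmonoidClass.coe_pow, coe_x, coe_u, coe_y, coe_mono,
          map_pow, mul_pow, ← pow_mul, hp]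
        ring
    · obtain ⟨β, γ, hβ⟩ := hgt (F + 1) (by omega)
      have := hsmall β γ
      refine ⟨mono n p (F + 1)
        (X_pow_mul_X_pow_mem_pow_of_le hbd (β := β) (γ := γ) (by omega) ?_ ?_), Subtype.ext ?_⟩
      · rw [← he]; omega
      · rw [← he]; omega
      · simp only [MulMemClass.coe_mul, SubmonoidClass.coe_pow, coe_x, coe_u, coe_y, coe_mono,
          map_pow, mul_pow, ← pow_mul, hp]
        ring
    · obtain ⟨β, γ, hβ⟩ := hgt (F + e) (by omega)
      have := hsmall β γ
      refine ⟨mono (n + 1) (p + b) (F + e)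
        (X_pow_mul_X_pow_mem_pow_of_le hbd (β := β) (γ := γ) (by omega) ?_ ?_), Subtype.ext ?_⟩
      · rw [← he]; omega
      · rw [← he, mul_add]; omega
      · simp only [MulMemClass.coe_mul, SubmonoidClass.coe_pow, coe_x, coe_u, coe_y, coe_v,
          coe_mono, map_pow, map_mul, mul_pow, ← pow_mul, hp, ← he]
        ring
    · obtain ⟨β, γ, hβ⟩ := hgt (F + d) (by omega)
      have := hsmall β γ
      refine ⟨mono (n + 1) p (F + d)
        (X_pow_mul_X_pow_mem_pow_of_le hbd (β := β) (γ := γ) (by omega) ?_ ?_), Subtype.ext ?_⟩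
      · rw [← he]; omega
      · rw [← he, mul_add]; omega
      · simp only [MulMemClass.coe_mul, SubmonoidClass.coe_pow, coe_x, coe_u, coe_y, coe_w,
          coe_mono, map_pow, mul_pow, ← pow_mul, hp]
        ring
  -- The fraction stays non-integral after localizing: `s` has nonzero constant term and the powers
  -- of the ideal are monomial.
  have hndvd : ∀ s ∉ reesGradedMaximal (binaryMonomialIdeal k d b),
      ¬ x k d b ^ F ∣ s * (u k d b ^ n * y k d b ^ F) := by
    rintro s hs ⟨a, ha⟩
    rw [gradedMaximal_eq_ker_aug, RingHom.mem_ker, aug_apply] at hs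
    replace ha := congrArg (fun a : BinaryRees k d b =>
      (a : Polynomial (MvPolynomial (Fin 2) k)).coeff n) ha
    have e₁ : ((s * (u k d b ^ n * y k d b ^ F) : BinaryRees k d b) :
        Polynomial (MvPolynomial (Fin 2) k)) =
        Polynomial.C (MvPolynomial.X 0 ^ (F + p) * MvPolynomial.X 1 ^ F) *
          (s.1 * Polynomial.X ^ n) := by
      simp only [MulMemClass.coe_mul, SubmonoidClass.coe_pow, coe_u, coe_y,
          map_pow, map_mul, mul_pow, ← pow_mul, hp]
      ring
    have e₂ : ((x k d b ^ F * a : BinaryRees k d b) : Polynomial (MvPolynomial (Fin 2) k)) =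
        Polynomial.C (MvPolynomial.X 0 ^ F) * a.1 := by
      simp only [MulMemClass.coe_mul, SubmonoidClass.coe_pow, coe_x, map_pow]
    simp only [e₁, e₂, Polynomial.coeff_C_mul] at ha
    have e₃ : (s.1 * Polynomial.X ^ n).coeff n = s.1.coeff 0 := by
      simpa using Polynomial.coeff_mul_X_pow s.1 n 0
    rw [e₃] at ha
    have e₄ : s.1.coeff 0 * (MvPolynomial.X 0 ^ p * MvPolynomial.X 1 ^ F) = a.1.coeff n := by
      apply mul_left_cancel₀ (pow_ne_zero F (MvPolynomial.X_ne_zero (0 : Fin 2)))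
      rw [← ha]
      ring
    have hmem : (MvPolynomial.X 0 ^ p * MvPolynomial.X 1 ^ F : MvPolynomial (Fin 2) k) ∈
        binaryMonomialIdeal k d b ^ n := mem_pow_of_mul_mem_pow hs (by rw [e₄]; exact a.2 n)
    obtain ⟨α, β, γ, hsum, h0, h1⟩ := X_pow_mul_X_pow_mem_pow.1 hmem
    -- Both sides have total degree `dn = F + p`, so the exponent inequalities are equalities.
    refine hF ⟨β, γ, ?_⟩
    rw [← he] at h1
    have : d * n = d * α + b * γ + (d * β + e * γ) := by
      rw [← hsum, ← hbe]; ring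
    omega
  set M := reesGradedMaximal (binaryMonomialIdeal k d b) with hM
  have hdom : IsDomain (Localization.AtPrime M) :=
    IsLocalization.isDomain_localization M.primeCompl_le_nonZeroDivisors
  obtain ⟨hnoeth, hdepth⟩ := hCM.2 M
  have hthree : (3 : ℕ∞) ≤ depthOn (A := Localization.AtPrime M)
      (IsLocalRing.maximalIdeal (Localization.AtPrime M)) := by
    rw [IsLocalization.AtPrime.ringKrullDim_eq_height M] at hdepth
    rw [WithBot.coe_inj.1 hdepth]
    exact three_le_height_gradedMaximal
  obtain ⟨a₁, ha₁, a₂, ha₂, a₃, ha₃, h₁, h₂, h₃⟩ := exists_regular_triple hthree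
  let φ := algebraMap (BinaryRees k d b) (Localization.AtPrime M)
  have hφ : Function.Injective φ :=
    IsLocalization.injective (Localization.AtPrime M) M.primeCompl_le_nonZeroDivisors
  have hx : x k d b ≠ 0 := fun h => MvPolynomial.X_ne_zero (0 : Fin 2)
    (Polynomial.C_eq_zero.1 (congrArg Subtype.val h))
  -- The fraction `g / f` is `x^p y^F T^n`, written with numerator and denominator in `A`.
  have hfin := dvd_of_regular_triple (B := Localization.AtPrime M)
    (Q := (Ideal.span {x k d b, y k d b, v k d b, w k d b}).map φ) (t := φ (u k d b))
    (f := φ (x k d b ^ F)) (g := φ (u k d b ^ n * y k d b ^ F)) ?_ ?_ ha₁ ha₂ ha₃ h₁ h₂ h₃ ?_ ?_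
  · obtain ⟨z, hz⟩ := hfin
    obtain ⟨⟨a, s⟩, has⟩ := IsLocalization.surj M.primeCompl z
    refine hndvd s s.2 ⟨a, hφ ?_⟩
    change z * φ s = φ a at has
    rw [map_mul, hz, map_mul φ (x k d b ^ F), ← has]
    ring
  · rw [Submodule.ne_bot_iff]
    exact ⟨φ (x k d b), Ideal.mem_map_of_mem _ (Ideal.subset_span (by simp)),
      (map_ne_zero_iff _ hφ).2 hx⟩
  · have hspan := congrArg (Ideal.map φ) (gradedMaximal_eq_span (k := k) (d := d) (b := b))
    rw [Ideal.map_sup, Ideal.map_span _ {u k d b}, Set.image_singleton] at hspan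
    exact Localization.AtPrime.map_eq_maximalIdeal.symm.trans hspan
  · exact (map_ne_zero_iff _ hφ).2 (pow_ne_zero _ hx)
  · intro q hq
    suffices h : (Ideal.span {x k d b, y k d b, v k d b, w k d b}).map φ ≤
        Submodule.comap (LinearMap.toSpanSingleton _ _ (φ (u k d b ^ n * y k d b ^ F)))
          (Ideal.span {φ (x k d b ^ F)}) from Ideal.mem_span_singleton.1 (h hq)
    rw [Ideal.map_span, Ideal.span_le]
    rintro _ ⟨q, hq, rfl⟩
    obtain ⟨c, hc⟩ := hdvd q hq
    refine Ideal.mem_span_singleton.2 ⟨φ c, ?_⟩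
    rw [LinearMap.toSpanSingleton_apply, smul_eq_mul, ← map_mul, hc, map_mul]

end NotCohenMacaulay

end BinaryRees

/-! ### Cohen–Macaulayness from freeness over a polynomial ring -/

section FreeOverPolynomial

-- `S[X]` is flat over `S`, and a monic polynomial is a nonzerodivisor in `(S/(rs))[X]`.
open Polynomial in
theorem RingTheory.Sequence.IsWeaklyRegular.polynomial_append_monic {S : Type*} [CommRing S]
    {rs : List S} (h : IsWeaklyRegular S rs) {f : S[X]} (hf : f.Monic) :
    IsWeaklyRegular S[X] (rs.map C ++ [f]) := by
  rw [isWeaklyRegular_append_iff, isWeaklyRegular_singleton_iff]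
  refine ⟨h.of_flat, ?_⟩
  rw [isSMulRegular_on_quot_iff_lsmul_comap_le, smul_eq_mul, Ideal.mul_top]
  intro g hg
  have hg' : f * g ∈ Ideal.ofList (rs.map C) := hg
  rw [← Ideal.map_ofList, ← Ideal.mk_ker (I := Ideal.ofList rs), ← Polynomial.ker_mapRingHom,
    RingHom.mem_ker] at hg' ⊢
  rw [map_mul] at hg'
  exact ((hf.map _).mul_right_eq_zero_iff).1 hg'

/-- By incomparability, contraction of primes is strictly monotone. -/
theorem ringKrullDim_le_of_isIntegral {C A : Type*} [CommRing C] [CommRing A] [Algebra C A]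
    [Algebra.IsIntegral C A] : ringKrullDim A ≤ ringKrullDim C :=
  Order.krullDim_le_of_strictMono (PrimeSpectrum.comap (algebraMap C A)) fun _ _ h =>
    Ideal.IsIntegral.comap_lt_comap h

-- By the Nullstellensatz `S/p` is finite over `k`, so the class of `z` is integral.
open Polynomial in
theorem exists_monic_aeval_mem_of_isMaximal {k S : Type*} [Field k] [CommRing S] [Algebra k S]
    [Algebra.FiniteType k S] (p : Ideal S) [p.IsMaximal] (z : S) :
    ∃ f : k[X], f.Monic ∧ aeval z f ∈ p := by
  let := Ideal.Quotient.field p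
  have : Module.Finite k (S ⧸ p) := finite_of_finite_type_of_isJacobsonRing k (S ⧸ p)
  have hz : IsIntegral k (Ideal.Quotient.mkₐ k p z) := Algebra.IsIntegral.isIntegral _
  obtain ⟨f, hf, h0⟩ := hz
  refine ⟨f, hf, ?_⟩
  rw [← Ideal.Quotient.eq_zero_iff_mem, ← Ideal.Quotient.mkₐ_eq_mk k, ← aeval_algHom_apply]
  exact h0

/-- Every maximal ideal of `S` contains a weakly regular sequence of length `n`. -/
def HasRegularSequences (S : Type*) [CommRing S] (n : ℕ) : Prop :=
  ∀ p : Ideal S, p.IsMaximal →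
    ∃ rs : List S, (∀ r ∈ rs, r ∈ p) ∧ IsWeaklyRegular S rs ∧ rs.length = n

theorem HasRegularSequences.of_ringEquiv {S S' : Type*} [CommRing S] [CommRing S'] {n : ℕ}
    (h : HasRegularSequences S n) (e : S ≃+* S') : HasRegularSequences S' n := by
  intro p hp
  obtain ⟨rs, hrs, hreg, hlen⟩ := h (p.comap e) (Ideal.comap_isMaximal_of_equiv e)
  refine ⟨rs.map e, ?_, ?_, by simpa using hlen⟩
  · intro r hr
    obtain ⟨s, hs, rfl⟩ := List.mem_map.1 hr
    exact hrs s hs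
  · refine (AddEquiv.isWeaklyRegular_congr (e := e.toAddEquiv) ?_).1 hreg
    rw [List.forall₂_map_right_iff, List.forall₂_same]
    exact fun r _ z => map_mul e r z

-- Over a Jacobson ring `p` contracts to a maximal ideal of `S`. A regular sequence there is
-- lengthened by a monic polynomial in `p`.
open Polynomial in
theorem HasRegularSequences.polynomial (k : Type*) {S : Type*} [Field k] [CommRing S]
    [Algebra k S] [Algebra.FiniteType k S] {n : ℕ} (h : HasRegularSequences S n) :
    HasRegularSequences S[X] (n + 1) := by
  intro p hp
  have : IsJacobsonRing S := isJacobsonRing_of_finiteType (A := k)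
  have hmax : (p.comap (C : S →+* S[X])).IsMaximal :=
    Polynomial.isMaximal_comap_C_of_isJacobsonRing p
  obtain ⟨rs, hrs, hreg, hlen⟩ := h _ hmax
  obtain ⟨f, hf, hfp⟩ := exists_monic_aeval_mem_of_isMaximal (k := k) p X
  rw [aeval_X_left_eq_map] at hfp
  refine ⟨_, ?_, hreg.polynomial_append_monic (hf.map (algebraMap k S)), by simp [hlen]⟩
  intro r hr
  rcases List.mem_append.1 hr with hr | hr
  · obtain ⟨s, hs, rfl⟩ := List.mem_map.1 hr
    exact hrs s hs
  · rw [List.mem_singleton.1 hr]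
    exact hfp

theorem hasRegularSequences_mvPolynomial (k : Type*) [Field k] (n : ℕ) :
    HasRegularSequences (MvPolynomial (Fin n) k) n := by
  induction n with
  | zero => exact fun p _ => ⟨[], by simp, IsWeaklyRegular.nil _ _, rfl⟩
  | succ n ih =>
    exact (ih.polynomial k).of_ringEquiv (MvPolynomial.finSuccEquiv k n).symm.toRingEquiv

/-- A ring that is finite free over a polynomial ring over a field is Cohen–Macaulay. -/
theorem isCohenMacaulay_of_free {k A : Type*} [Field k] (n : ℕ) [CommRing A]
    [Algebra (MvPolynomial (Fin n) k) A] [Module.Free (MvPolynomial (Fin n) k) A]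
    [Module.Finite (MvPolynomial (Fin n) k) A] : IsCohenMacaulay A := by
  have hnoeth : IsNoetherianRing A := IsNoetherianRing.of_finite (MvPolynomial (Fin n) k) A
  refine ⟨hnoeth, fun P hP => ⟨inferInstance, le_antisymm depthOn_maximalIdeal_le_ringKrullDim ?_⟩⟩
  obtain ⟨rs, hrs, hreg, hlen⟩ := hasRegularSequences_mvPolynomial k n
    (P.comap (algebraMap (MvPolynomial (Fin n) k) A))
    (Ideal.isMaximal_comap_of_isIntegral_of_isMaximal P)
  -- Freeness enters here: regular sequences ascend along flat maps.
  have hA : IsWeaklyRegular A (rs.map (algebraMap _ A)) := hreg.of_flat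
  have hmemA : ∀ r ∈ rs.map (algebraMap _ A), r ∈ P := by
    intro r hr
    obtain ⟨s, hs, rfl⟩ := List.mem_map.1 hr
    exact hrs s hs
  have hloc := hA.isRegular_of_isLocalization_of_mem (Localization.AtPrime P) P hmemA
  have hdepth : (n : ℕ∞) ≤ depthOn (A := Localization.AtPrime P)
      (IsLocalRing.maximalIdeal (Localization.AtPrime P)) := by
    have := le_depthOn (A := Localization.AtPrime P)
      (J := IsLocalRing.maximalIdeal (Localization.AtPrime P)) ?_ hloc
    · simpa [hlen] using this
    · intro r hr
      obtain ⟨s, hs, rfl⟩ := List.mem_map.1 hr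
      exact (IsLocalization.AtPrime.to_map_mem_maximal_iff _ P s).2 (hmemA s hs)
  have hdim : ringKrullDim (Localization.AtPrime P) ≤ n := by
    rw [IsLocalization.AtPrime.ringKrullDim_eq_height P]
    refine Ideal.height_le_ringKrullDim_of_isPrime.trans
      ((ringKrullDim_le_of_isIntegral (C := MvPolynomial (Fin n) k)).trans ?_)
    rw [MvPolynomial.ringKrullDim_of_isNoetherianRing, ringKrullDim_eq_zero_of_field]
    simp
  exact hdim.trans (by exact_mod_cast hdepth)

open Polynomial in
/-- If `q` has degree three, then `1, X, v` with `deg v = 2` are independent over `K[q]`. -/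
theorem eq_zero_of_comp_add_comp_add_comp {K : Type*} [Field K] {q v : K[X]}
    (hq : q.natDegree = 3) (hv : v.natDegree = 2) {p : Fin 3 → K[X]}
    (h : (p 0).comp q + (p 1).comp q * X + (p 2).comp q * v = 0) (i : Fin 3) : p i = 0 := by
  have hcomp : ∀ p : K[X], p.comp q = 0 → p = 0 := by
    intro p hp
    rcases Polynomial.comp_eq_zero_iff.1 hp with h | ⟨-, h⟩
    · exact h
    · rw [h, natDegree_C] at hq
      omega
  have hv0 : v ≠ 0 := by
    rintro rfl
    simp at hv
  let b : Fin 3 → K[X] := ![1, X, v]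
  have hb0 : ∀ i, b i ≠ 0 := by
    intro i
    fin_cases i
    · exact one_ne_zero
    · exact X_ne_zero
    · exact hv0
  have hbdeg : ∀ i, (b i).natDegree = i := by
    intro i
    fin_cases i
    · exact natDegree_one
    · exact natDegree_X
    · exact hv
  have hsum : ∑ i, (p i).comp q * b i = 0 := by
    rw [Fin.sum_univ_three]
    simpa [b] using h
  have hdeg : ∀ i, (p i).comp q * b i ≠ 0 →
      ((p i).comp q * b i).natDegree = 3 * (p i).natDegree + i := by
    intro i hi
    rw [natDegree_mul (left_ne_zero_of_mul hi) (hb0 i), natDegree_comp, hq, hbdeg, mul_comm]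
  -- The nonzero summands have degrees distinct modulo 3, so no leading terms cancel.
  have hsup := degree_sum_eq_of_disjoint (fun i => (p i).comp q * b i) Finset.univ (by
    intro i hi j hj hij heq
    have h1 := natDegree_eq_of_degree_eq heq
    simp only at h1
    rw [hdeg i hi.2, hdeg j hj.2] at h1
    exact hij (Fin.ext (by omega)))
  rw [hsum, degree_zero] at hsup
  have hi : ((p i).comp q * b i).degree = ⊥ := by
    rw [eq_bot_iff, hsup]
    exact Finset.le_sup (f := fun i => ((p i).comp q * b i).degree) (Finset.mem_univ i)
  exact hcomp _ ((mul_eq_zero.1 (degree_eq_bot.1 hi)).resolve_right (hb0 i))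

end FreeOverPolynomial

/-! ### The case `d = 2`: a basis over three parameters -/

namespace BinaryRees

section Veronese

variable {k : Type*} [Field k]

/-- The parameters `x²T, y²T + x, y` of the Rees algebra of `(x², y², xy)`. -/
noncomputable def parameters (k : Type*) [Field k] :
    MvPolynomial (Fin 3) k →ₐ[k] BinaryRees k 2 1 :=
  MvPolynomial.aeval ![u k 2 1, w k 2 1 + x k 2 1, y k 2 1]

/-- The function field of the parameters `y²T + x` and `y`. -/
abbrev ParameterField (k : Type*) [Field k] := FractionRing (MvPolynomial (Fin 2) k)

/-- The image of `T` under the specialization below. -/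
noncomputable def specializedT (k : Type*) [Field k] : Polynomial (ParameterField k) :=
  Polynomial.C ((algebraMap _ (ParameterField k) (MvPolynomial.X 1 : MvPolynomial (Fin 2) k) ^ 2)⁻¹)
    * (Polynomial.C (algebraMap _ (ParameterField k) (MvPolynomial.X 0 : MvPolynomial (Fin 2) k))
      - Polynomial.X)

/-- The substitution `x ↦ X`, `y ↦ c`, `T ↦ (a - X) / c²`, where `a, c` are transcendental;
it sends `y²T + x` to the constant `a`. -/
noncomputable def specialize (k : Type*) [Field k] :
    Polynomial (MvPolynomial (Fin 2) k) →+* Polynomial (ParameterField k) :=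
  Polynomial.eval₂RingHom
    (MvPolynomial.aeval (R := k) ![Polynomial.X, Polynomial.C (algebraMap _ (ParameterField k)
      (MvPolynomial.X 1 : MvPolynomial (Fin 2) k))]).toRingHom
    (specializedT k)

theorem algebraMap_X_ne_zero (i : Fin 2) : algebraMap (MvPolynomial (Fin 2) k) (ParameterField k)
    (MvPolynomial.X i) ≠ 0 :=
  (map_ne_zero_iff _ (IsFractionRing.injective _ _)).2 (MvPolynomial.X_ne_zero i)

theorem natDegree_specializedT : (specializedT k).natDegree = 1 := by
  rw [specializedT,
    Polynomial.natDegree_C_mul (inv_ne_zero (pow_ne_zero _ (algebraMap_X_ne_zero 1))),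
    Polynomial.natDegree_sub, Polynomial.natDegree_X_sub_C]

theorem specialize_X : specialize k Polynomial.X = specializedT k := by
  simp [specialize]

theorem specialize_C_X_zero : specialize k (Polynomial.C (MvPolynomial.X 0)) = Polynomial.X := by
  simp [specialize]

theorem specialize_C_X_one : specialize k (Polynomial.C (MvPolynomial.X 1)) =
    Polynomial.C (algebraMap (MvPolynomial (Fin 2) k) (ParameterField k)
      (MvPolynomial.X 1)) := by
  simp [specialize]

theorem specialize_C_C (c : k) : specialize k (Polynomial.C (MvPolynomial.C c)) =
    Polynomial.C (algebraMap (MvPolynomial (Fin 2) k) (ParameterField k)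
      (MvPolynomial.C c)) := by
  simp only [specialize, Polynomial.coe_eval₂RingHom, Polynomial.eval₂_C]
  exact (MvPolynomial.aeval _).commutes c

theorem C_sq_mul_specializedT :
    Polynomial.C (algebraMap (MvPolynomial (Fin 2) k) (ParameterField k) (MvPolynomial.X 1)) ^ 2 *
      specializedT k = Polynomial.C (algebraMap (MvPolynomial (Fin 2) k) (ParameterField k)
      (MvPolynomial.X 0)) - Polynomial.X := by
  rw [specializedT, ← mul_assoc, ← map_pow, ← map_mul,
    mul_inv_cancel₀ (pow_ne_zero _ (algebraMap_X_ne_zero 1)), map_one, one_mul]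

theorem specialize_u : specialize k (u k 2 1).1 = Polynomial.X ^ 2 * specializedT k := by
  rw [coe_u, map_mul, map_pow, map_pow, specialize_X, specialize_C_X_zero]

theorem specialize_v : specialize k (v k 2 1).1 = Polynomial.X *
    Polynomial.C (algebraMap (MvPolynomial (Fin 2) k) (ParameterField k)
      (MvPolynomial.X 1)) * specializedT k := by
  rw [coe_v, map_mul, pow_one, Nat.add_one_sub_one, pow_one, map_mul, map_mul, specialize_X,
    specialize_C_X_zero, specialize_C_X_one]

theorem specialize_w_add_x : specialize k (w k 2 1 + x k 2 1).1 =
    Polynomial.C (algebraMap (MvPolynomial (Fin 2) k) (ParameterField k)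
      (MvPolynomial.X 0)) := by
  rw [AddMemClass.coe_add, coe_w, coe_x, map_add, map_mul, map_pow, map_pow, specialize_X,
    specialize_C_X_zero, specialize_C_X_one, C_sq_mul_specializedT, sub_add_cancel]

/-- The specialization fixes two parameters as the constants `a`, `c` and sends `u` to a cubic `q`.
On the parameter ring it is therefore substitution of `q` for the first variable, and independence
of `1, x, v` becomes a degree count over `k(a, c)`. -/
theorem specialize_parameters (c : MvPolynomial (Fin 3) k) :
    specialize k (parameters k c).1 =
      ((MvPolynomial.finSuccEquiv k 2 c).map (algebraMap _ (ParameterField k))).comp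
        (Polynomial.X ^ 2 * specializedT k) := by
  let F : MvPolynomial (Fin 3) k →+* Polynomial (ParameterField k) :=
    ((specialize k).comp (reesAlgebra (binaryMonomialIdeal k 2 1)).val.toRingHom).comp
      (parameters k).toRingHom
  let G : MvPolynomial (Fin 3) k →+* Polynomial (ParameterField k) :=
    ((Polynomial.compRingHom (Polynomial.X ^ 2 * specializedT k)).comp
      (Polynomial.mapRingHom (algebraMap _ (ParameterField k)))).comp
        (MvPolynomial.finSuccEquiv k 2).toRingEquiv.toRingHom
  have hF : ∀ c, F c = specialize k (parameters k c).1 := fun _ => rfl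
  have hG : ∀ c, G c = ((MvPolynomial.finSuccEquiv k 2 c).map
    (algebraMap _ (ParameterField k))).comp (Polynomial.X ^ 2 * specializedT k) := fun _ => rfl
  rw [← hF, ← hG]
  congr 1
  refine MvPolynomial.ringHom_ext (fun c => ?_) fun i => ?_
  · rw [hF, hG, MvPolynomial.finSuccEquiv_apply, MvPolynomial.eval₂Hom_C]
    have : (parameters k (MvPolynomial.C c)).1 = Polynomial.C (MvPolynomial.C c) :=
      congrArg Subtype.val ((parameters k).commutes c)
    rw [this, specialize_C_C]
    simp
  · rw [hF, hG, parameters, MvPolynomial.aeval_X]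
    fin_cases i
    · change specialize k (u k 2 1).1 = _
      rw [specialize_u]
      simp [MvPolynomial.finSuccEquiv_X_zero]
    · change specialize k (w k 2 1 + x k 2 1).1 =
        ((MvPolynomial.finSuccEquiv k 2 (MvPolynomial.X (Fin.succ 0))).map _).comp _
      rw [specialize_w_add_x, MvPolynomial.finSuccEquiv_X_succ]
      simp
    · change specialize k (y k 2 1).1 =
        ((MvPolynomial.finSuccEquiv k 2 (MvPolynomial.X (Fin.succ 1))).map _).comp _
      rw [coe_y, specialize_C_X_one, MvPolynomial.finSuccEquiv_X_succ]
      simp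

theorem x_mul_x : x k 2 1 * x k 2 1 =
    (w k 2 1 + x k 2 1) * x k 2 1 - y k 2 1 * v k 2 1 := by
  refine Subtype.ext ?_
  simp only [MulMemClass.coe_mul, AddMemClass.coe_add, AddSubgroupClass.coe_sub, coe_x, coe_y,
    coe_v, coe_w, map_mul, map_pow]
  ring

theorem x_mul_v : x k 2 1 * v k 2 1 = u k 2 1 * y k 2 1 := by
  refine Subtype.ext ?_
  simp only [MulMemClass.coe_mul, coe_x, coe_y, coe_v, coe_u, map_mul, map_pow]
  ring

theorem v_mul_v : v k 2 1 * v k 2 1 = u k 2 1 * (w k 2 1 + x k 2 1) - u k 2 1 * x k 2 1 := by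
  refine Subtype.ext ?_
  simp only [MulMemClass.coe_mul, AddMemClass.coe_add, AddSubgroupClass.coe_sub, coe_x,
    coe_v, coe_w, coe_u, map_mul, map_pow]
  ring

theorem parameters_X_zero : parameters k (MvPolynomial.X 0) = u k 2 1 := by simp [parameters]

theorem parameters_X_one : parameters k (MvPolynomial.X 1) = w k 2 1 + x k 2 1 := by
  simp [parameters]

theorem parameters_X_two : parameters k (MvPolynomial.X 2) = y k 2 1 := by simp [parameters]

theorem parameters_combination_eq_zero {g : Fin 3 → MvPolynomial (Fin 3) k}
    (h : parameters k (g 0) + parameters k (g 1) * x k 2 1 + parameters k (g 2) * v k 2 1 = 0)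
    (i : Fin 3) : g i = 0 := by
  have h' := congrArg (fun a : BinaryRees k 2 1 => specialize k a.1) h
  simp only [AddMemClass.coe_add, MulMemClass.coe_mul, map_add, map_mul, specialize_parameters,
    ZeroMemClass.coe_zero, map_zero, coe_x, specialize_C_X_zero, specialize_v] at h'
  have hT : specializedT k ≠ 0 := by
    intro h0
    have := natDegree_specializedT (k := k)
    simp [h0] at this
  have hq : (Polynomial.X ^ 2 * specializedT k).natDegree = 3 := by
    rw [Polynomial.natDegree_mul (pow_ne_zero _ Polynomial.X_ne_zero) hT,
      natDegree_specializedT, Polynomial.natDegree_X_pow]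
  have hc : (Polynomial.C (algebraMap (MvPolynomial (Fin 2) k) (ParameterField k)
      (MvPolynomial.X 1))) ≠ 0 := Polynomial.C_ne_zero.2 (algebraMap_X_ne_zero 1)
  have hv : (Polynomial.X * Polynomial.C (algebraMap (MvPolynomial (Fin 2) k) (ParameterField k)
      (MvPolynomial.X 1)) * specializedT k).natDegree = 2 := by
    rw [Polynomial.natDegree_mul (mul_ne_zero Polynomial.X_ne_zero hc) hT,
      Polynomial.natDegree_mul Polynomial.X_ne_zero hc, natDegree_specializedT,
      Polynomial.natDegree_X, Polynomial.natDegree_C]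
  have h0 := eq_zero_of_comp_add_comp_add_comp hq hv
    (p := fun i => (MvPolynomial.finSuccEquiv k 2 (g i)).map (algebraMap _ (ParameterField k))) h' i
  exact (map_eq_zero_iff _ (MvPolynomial.finSuccEquiv k 2).injective).1
    ((Polynomial.map_eq_zero_iff (IsFractionRing.injective (MvPolynomial (Fin 2) k)
      (ParameterField k))).1 h0)

theorem exists_parameters_combination (a : BinaryRees k 2 1) :
    ∃ g₀ g₁ g₂ : MvPolynomial (Fin 3) k,
      a = parameters k g₀ + parameters k g₁ * x k 2 1 + parameters k g₂ * v k 2 1 := by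
  let S : Subalgebra k (BinaryRees k 2 1) :=
    { carrier := {a | ∃ g₀ g₁ g₂ : MvPolynomial (Fin 3) k,
        a = parameters k g₀ + parameters k g₁ * x k 2 1 + parameters k g₂ * v k 2 1}
      add_mem' := by
        rintro _ _ ⟨g₀, g₁, g₂, rfl⟩ ⟨h₀, h₁, h₂, rfl⟩
        refine ⟨g₀ + h₀, g₁ + h₁, g₂ + h₂, ?_⟩
        simp only [map_add]
        ring
      mul_mem' := by
        rintro _ _ ⟨g₀, g₁, g₂, rfl⟩ ⟨h₀, h₁, h₂, rfl⟩
        -- Coefficients obtained by rewriting `x²`, `xv` and `v²` through `x_mul_x`, `x_mul_v` and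
        -- `v_mul_v`.
        refine ⟨g₀ * h₀ + (g₁ * h₂ + g₂ * h₁) * (MvPolynomial.X 0 * MvPolynomial.X 2) +
            g₂ * h₂ * (MvPolynomial.X 0 * MvPolynomial.X 1),
          g₀ * h₁ + g₁ * h₀ + g₁ * h₁ * MvPolynomial.X 1 - g₂ * h₂ * MvPolynomial.X 0,
          g₀ * h₂ + g₂ * h₀ - g₁ * h₁ * MvPolynomial.X 2, ?_⟩
        simp only [map_add, map_sub, map_mul, parameters_X_zero, parameters_X_one,
          parameters_X_two]
        linear_combination parameters k g₁ * parameters k h₁ * x_mul_x (k := k) +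
          (parameters k g₁ * parameters k h₂ + parameters k g₂ * parameters k h₁) *
            x_mul_v (k := k) + parameters k g₂ * parameters k h₂ * v_mul_v (k := k)
      algebraMap_mem' := fun c => ⟨algebraMap _ _ c, 0, 0, by simp⟩ }
  have hS : S = ⊤ := by
    refine eq_top_of_mem S ⟨0, 1, 0, by simp⟩ ⟨MvPolynomial.X 2, 0, 0, ?_⟩
      ⟨MvPolynomial.X 0, 0, 0, ?_⟩ ⟨0, 0, 1, by simp⟩ ⟨MvPolynomial.X 1, -1, 0, ?_⟩
    · simp [parameters_X_two]
    · simp [parameters_X_zero]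
    · simp only [parameters_X_one, map_neg, map_one, map_zero]
      ring
  exact (hS ▸ Algebra.mem_top : a ∈ S)

theorem isCohenMacaulay_two : IsCohenMacaulay (BinaryRees k 2 1) := by
  let := (parameters k).toRingHom.toAlgebra
  have hsmul : ∀ (g : MvPolynomial (Fin 3) k) (a : BinaryRees k 2 1),
      g • a = parameters k g * a := fun _ _ => rfl
  have hli : LinearIndependent (MvPolynomial (Fin 3) k) ![1, x k 2 1, v k 2 1] := by
    rw [Fintype.linearIndependent_iff]
    intro g hg i
    rw [Fin.sum_univ_three] at hg
    refine parameters_combination_eq_zero (g := g) ?_ i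
    simpa [hsmul] using hg
  have hspan : ⊤ ≤ Submodule.span (MvPolynomial (Fin 3) k)
      (Set.range ![1, x k 2 1, v k 2 1]) := by
    rintro a -
    obtain ⟨g₀, g₁, g₂, rfl⟩ := exists_parameters_combination a
    have hmem : ∀ (g : MvPolynomial (Fin 3) k) (i : Fin 3),
        parameters k g * ![1, x k 2 1, v k 2 1] i ∈ Submodule.span (MvPolynomial (Fin 3) k)
          (Set.range ![1, x k 2 1, v k 2 1]) := fun g i =>
      Submodule.smul_mem _ g (Submodule.subset_span ⟨i, rfl⟩)
    refine Submodule.add_mem _ (Submodule.add_mem _ ?_ (hmem g₁ 1)) (hmem g₂ 2)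
    simpa using hmem g₀ 0
  let B := Module.Basis.mk hli hspan
  have : Module.Free (MvPolynomial (Fin 3) k) (BinaryRees k 2 1) := Module.Free.of_basis B
  have : Module.Finite (MvPolynomial (Fin 3) k) (BinaryRees k 2 1) := Module.Finite.of_basis B
  exact isCohenMacaulay_of_free (k := k) 3

end Veronese

end BinaryRees

theorem theorem2p6 {k : Type*} [Field k] (d b : ℕ) (hd : 2 ≤ d) (hb : b ≤ d - b)
    (hgcd : Nat.gcd d b = 1) :
    IsAlmostCohenMacaulayRees (binaryMonomialIdeal k d b) ∧
      (IsCohenMacaulay (reesAlgebra (binaryMonomialIdeal k d b)) ↔ d = 2) := by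
  refine ⟨BinaryRees.isAlmostCohenMacaulayRees (by omega), fun hCM => ?_, ?_⟩
  · by_contra hne
    exact BinaryRees.not_isCohenMacaulay (by omega) hb hgcd hCM
  · rintro rfl
    obtain rfl : b = 1 := by
      obtain rfl | h : b = 0 ∨ b = 1 := by omega
      · simp at hgcd
      · exact h
    exact BinaryRees.isCohenMacaulay_two
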